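/- Let $\mathbb T^2=\mathbb R^2/\mathbb Z^2$ be equipped with its standard symplectic (area) form $\omega=dx\wedge dy$. For a smooth Riemannian metric $g$ on $\mathbb T^2$ with induced distance $d_g$ and a map $f:\mathbb T^2\to\mathbb T^2$, put $\Vert f\Vert_{C^0}=\sup_{x\in\mathbb T^2} d_g(x,f(x))$. For every real number $C>1$ there exist a smooth Riemannian metric $g=g_C$ on $\mathbb T^2$ and a smooth diffeomorphism $\varphi$ of $\mathbb T^2$ with $\varphi^*\omega=\omega$ such that: 1. $\varphi$ lies in the identity component $\mathrm{Symp}_0(\mathbb T^2,\omega)$, i.e. there is a smooth family $(\phi_t)_{t\in[0,1]}$ of $\omega$-preserving diffeomorphisms with $\phi_0=\mathrm{Id}$ and $\phi_1=\varphi$; 2. there is no isotopy $(\varphi_t)_{t\in[0,1]}$ (a continuous family of homeomorphisms of $\mathbb T^2$; in particular no smooth isotopy, area-preserving or not) with $\varphi_0=\mathrm{Id}$, $\varphi_1=\varphi$ and $$\Vert\varphi_t\Vert_{C^0}\le C\,\Vert\varphi\Vert_{C^0}\qquad\text{for all } t\in[0,1].$$ -/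

import Mathlib

open Set Manifold Bundle
open scoped Topology ContDiff ENNReal

noncomputable section

/-- The two-dimensional torus `ℝ²/ℤ² = ℝ/ℤ × ℝ/ℤ`. -/
abbrev Torus : Type := UnitAddCircle × UnitAddCircle

/-- The quotient map `ℝ² → ℝ²/ℤ²`. -/
def torusProj (p : ℝ × ℝ) : Torus := ((p.1 : UnitAddCircle), (p.2 : UnitAddCircle))

theorem torusProj_add (p q : ℝ × ℝ) : torusProj (p + q) = torusProj p + torusProj q := rfl

theorem torusProj_sub (p q : ℝ × ℝ) : torusProj (p - q) = torusProj p - torusProj q := rfl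

theorem torusProj_surjective : Function.Surjective torusProj := by
  rintro ⟨a, b⟩
  obtain ⟨x, rfl⟩ := QuotientAddGroup.mk_surjective a
  obtain ⟨y, rfl⟩ := QuotientAddGroup.mk_surjective b
  exact ⟨(x, y), rfl⟩

theorem torusProj_isLocalHomeomorph : IsLocalHomeomorph torusProj := by
  rintro ⟨x, y⟩
  obtain ⟨e, he, hef⟩ := AddCircle.isLocalHomeomorph_coe (1 : ℝ) x
  obtain ⟨e', he', hef'⟩ := AddCircle.isLocalHomeomorph_coe (1 : ℝ) y
  refine ⟨e.prod e', ⟨he, he'⟩, ?_⟩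
  funext p
  exact Prod.ext (congrFun hef p.1) (congrFun hef' p.2)

/-- The atlas of `ℝ²/ℤ²`: the charts are local inverses of the quotient map `ℝ² → ℝ²/ℤ²`. -/
instance torusChartedSpace : ChartedSpace (ℝ × ℝ) Torus :=
  torusProj_isLocalHomeomorph.chartedSpace torusProj_surjective

theorem torus_chart_symm {e : OpenPartialHomeomorph Torus (ℝ × ℝ)}
    (he : e ∈ atlas (ℝ × ℝ) Torus) (p : ℝ × ℝ) : e.symm p = torusProj p := by
  obtain ⟨q, rfl⟩ := he
  change (torusProj_isLocalHomeomorph.localInverseAt _).symm p = torusProj p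
  rw [IsLocalHomeomorph.localInverseAt_symm]

/-- In every chart of the atlas the quotient map is locally a translation. -/
theorem torus_chart_comp_proj {e : OpenPartialHomeomorph Torus (ℝ × ℝ)}
    (he : e ∈ atlas (ℝ × ℝ) Torus) {p : ℝ × ℝ} (hp : torusProj p ∈ e.source) :
    (fun q => e (torusProj q)) =ᶠ[𝓝 p] fun q => q + (e (torusProj p) - p) := by
  have h0 : torusProj (e (torusProj p)) = torusProj p := by
    rw [← torus_chart_symm he, e.left_inv hp]
  have hc : ContinuousAt (fun q : ℝ × ℝ => q + (e (torusProj p) - p)) p := by fun_prop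
  have hm : e.target ∈ 𝓝 ((fun q : ℝ × ℝ => q + (e (torusProj p) - p)) p) := by
    apply e.open_target.mem_nhds
    simpa using e.map_source hp
  filter_upwards [hc hm] with q hq
  have h1 : torusProj (q + (e (torusProj p) - p)) = torusProj q := by
    rw [torusProj_add, torusProj_sub, h0, sub_self, add_zero]
  rw [← h1, ← torus_chart_symm he]
  exact e.right_inv hq

instance torusIsManifold (n : ℕ∞ω) : IsManifold 𝓘(ℝ, ℝ × ℝ) n Torus := by
  refine isManifold_of_contDiffOn _ _ _ fun e e' he he' => ?_
  rintro p ⟨hp, -⟩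
  have hp' : torusProj p ∈ e'.source := by
    rw [← torus_chart_symm he]
    exact hp.2
  have h := torus_chart_comp_proj he' hp'
  have h2 : ContDiffAt ℝ n (fun q : ℝ × ℝ => q + (e' (torusProj p) - p)) p := by fun_prop
  refine ((h2.congr_of_eventuallyEq h).congr_of_eventuallyEq ?_).contDiffWithinAt
  refine Filter.Eventually.of_forall fun q => ?_
  simp [torus_chart_symm he]

/-- The standard area form `dx ∧ dy` on `ℝ²/ℤ²`. A tangent vector is read as an element of `ℝ²` in
the preferred chart at its base point, which is a local inverse of the quotient map; see
`torusArea_pullback`. -/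
def torusArea (x : Torus) (v w : TangentSpace 𝓘(ℝ, ℝ × ℝ) x) : ℝ :=
  let v' : ℝ × ℝ := v
  let w' : ℝ × ℝ := w
  v'.1 * w'.2 - v'.2 * w'.1

theorem hasMFDerivAt_torusProj (p : ℝ × ℝ) :
    HasMFDerivAt 𝓘(ℝ, ℝ × ℝ) 𝓘(ℝ, ℝ × ℝ) torusProj p (ContinuousLinearMap.id ℝ (ℝ × ℝ)) := by
  refine ⟨torusProj_isLocalHomeomorph.continuous.continuousAt, ?_⟩
  have h := torus_chart_comp_proj (chart_mem_atlas (ℝ × ℝ) (torusProj p))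
    (mem_chart_source (ℝ × ℝ) (torusProj p))
  have h2 : HasFDerivAt (fun q : ℝ × ℝ => q + (chartAt (ℝ × ℝ) (torusProj p) (torusProj p) - p))
      (ContinuousLinearMap.id ℝ (ℝ × ℝ)) p := (hasFDerivAt_id p).add_const _
  exact (h2.congr_of_eventuallyEq h).hasFDerivWithinAt

/-- The pullback of the area form to `ℝ²` is `dx ∧ dy`. -/
theorem torusArea_pullback (p v w : ℝ × ℝ) :
    torusArea (torusProj p) (mfderiv 𝓘(ℝ, ℝ × ℝ) 𝓘(ℝ, ℝ × ℝ) torusProj p v)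
      (mfderiv 𝓘(ℝ, ℝ × ℝ) 𝓘(ℝ, ℝ × ℝ) torusProj p w) = v.1 * w.2 - v.2 * w.1 := by
  rw [(hasMFDerivAt_torusProj p).mfderiv]
  rfl

/-- Smooth Riemannian metrics on the torus. -/
abbrev TorusMetric : Type :=
  ContMDiffRiemannianMetric 𝓘(ℝ, ℝ × ℝ) ∞ (ℝ × ℝ)
    (TangentSpace 𝓘(ℝ, ℝ × ℝ) : Torus → Type)

/-- The Riemannian distance of `g`: the infimum of the `g`-lengths of `C¹` paths from `x` to `y`. -/
def TorusMetric.edist (g : TorusMetric) (x y : Torus) : ℝ≥0∞ :=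
  letI : RiemannianBundle (TangentSpace 𝓘(ℝ, ℝ × ℝ) : Torus → Type) :=
    ⟨g.toRiemannianMetric⟩
  riemannianEDist 𝓘(ℝ, ℝ × ℝ) x y

/-- The `C⁰`-norm `sup_x d(x, f x)` for the distance `d` of the Riemannian metric `g`. -/
def TorusMetric.cZeroNorm (g : TorusMetric) (f : Torus → Torus) : ℝ≥0∞ :=
  ⨆ x : Torus, TorusMetric.edist g x (f x)

/-- Smooth diffeomorphisms of the torus. -/
abbrev TorusDiffeo : Type := Diffeomorph 𝓘(ℝ, ℝ × ℝ) 𝓘(ℝ, ℝ × ℝ) Torus Torus ∞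

/-- `φ` preserves the standard area form: `φ^* (dx ∧ dy) = dx ∧ dy`. -/
def IsAreaPreserving (φ : TorusDiffeo) : Prop :=
  ∀ (x : Torus) (v w : TangentSpace 𝓘(ℝ, ℝ × ℝ) x),
    torusArea (φ x) (mfderiv 𝓘(ℝ, ℝ × ℝ) 𝓘(ℝ, ℝ × ℝ) φ x v)
      (mfderiv 𝓘(ℝ, ℝ × ℝ) 𝓘(ℝ, ℝ × ℝ) φ x w) = torusArea x v w

/-- `φ` lies in the identity component of the group of area-preserving diffeomorphisms: there is a
smooth family `(φ_t)`, `t ∈ [0, 1]`, of such diffeomorphisms with `φ_0 = id` and `φ_1 = φ`. -/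
def IsInSympZero (φ : TorusDiffeo) : Prop :=
  ∃ Φ : unitInterval → TorusDiffeo,
    ContMDiff ((𝓡∂ 1).prod 𝓘(ℝ, ℝ × ℝ)) 𝓘(ℝ, ℝ × ℝ) ∞
      (fun q : unitInterval × Torus => Φ q.1 q.2) ∧
    (∀ t, IsAreaPreserving (Φ t)) ∧
    (∀ x, Φ 0 x = x) ∧ (∀ x, Φ 1 x = φ x)

/-- `Ψ` is a (topological) isotopy from the identity to `f`: a continuous family of homeomorphisms
`Ψ_t`, `t ∈ [0, 1]`, with `Ψ_0 = id` and `Ψ_1 = f`. In particular every smooth isotopy through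
diffeomorphisms, area-preserving or not, is one. -/
def IsIsotopyFromId (Ψ : unitInterval → Torus ≃ₜ Torus) (f : Torus → Torus) : Prop :=
  Continuous (fun q : unitInterval × Torus => Ψ q.1 q.2) ∧
    (∀ x, Ψ 0 x = x) ∧ (∀ x, Ψ 1 x = f x)

end

/-! The map is the shear `(x, y) ↦ (x, y + sin² (π x))`, and the metric is `M² dx² + b(x)² dy²` with
`b = warp ε`. The vertical circles over `x = 0` and `x = 1/2` have length `1`, while the shear fixes
them pointwise: it turns the first by `0` and the second by one full turn. Elsewhere `b` is so small
that `b` times the distance from `sin² (π x)` to the nearest integer is at most `ε`. Hence the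
`C⁰`-norm of the shear is at most `ε` (`cZeroNorm_torusShearDiffeo_le`), whatever `M` is.

For `M` large, the points `(0, 0)` and `(1/2, 0)` are at distance at least `1/9` from the circle `y
= 1/2` (`one_le_edist_warpedMetric`), because a suitable `9`-Lipschitz function separates them from
it. If `9 C ε < 1`, an isotopy of norm at most `C` times that of the shear keeps the tracks of both
points off this circle. Lifting the second coordinate along `y = 0` to `ℝ`, neither point can make a
full turn; yet the final lift is `sin² (π x)`, which gains `1` between them
(`not_exists_circle_homotopy`). -/

open Set Manifold Bundle
open scoped Topology ContDiff ENNReal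

noncomputable section

/-! ### Lifting obstruction for maps to the circle. -/

/-- A continuous real function on a preconnected space, all of whose values are integers modulo
`1`, and which vanishes somewhere, is zero. -/
theorem eq_zero_of_continuous_of_coe_eq_zero {X : Type*} [TopologicalSpace X] [PreconnectedSpace X]
    {f : X → ℝ} (hf : Continuous f) (h : ∀ x, ((f x : ℝ) : UnitAddCircle) = 0) {x₀ : X}
    (h₀ : f x₀ = 0) (x : X) : f x = 0 := by
  -- Both `f` and `0` lift the constant map through the covering `ℝ → ℝ/ℤ`, and they agree at `x₀`.
  have h1 := (AddCircle.isCoveringMap_coe (1 : ℝ)).eq_of_comp_eq hf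
    (continuous_const (y := (0 : ℝ))) (by funext y; simpa using h y) x₀ h₀
  exact congrFun h1 x

/-- A real path starting at `0` and avoiding `1/2` modulo `1` stays in `(-1/2, 1/2)`. -/
theorem abs_lt_half_of_coe_ne_half {f : unitInterval → ℝ} (hf : Continuous f) (h₀ : f 0 = 0)
    (h : ∀ t, ((f t : ℝ) : UnitAddCircle) ≠ ((1 / 2 : ℝ) : UnitAddCircle)) (t : unitInterval) :
    |f t| < 1 / 2 := by
  by_contra! hc
  obtain ⟨s, hs⟩ := mem_range_of_exists_le_of_exists_ge (continuous_abs.comp hf)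
    ⟨0, by simp [h₀]⟩ ⟨t, hc⟩
  have hs : |f s| = 1 / 2 := hs
  rcases (abs_eq (by norm_num)).1 hs with h1 | h1
  · exact h s (by rw [h1])
  · apply h s
    rw [h1, ← sub_eq_zero, ← AddCircle.coe_sub, AddCircle.coe_eq_zero_iff]
    exact ⟨-1, by norm_num⟩

/-- A homotopy of maps to the circle starting at the constant map `0`, whose tracks over two points
avoid `1/2`, cannot end at a map having a real lift with the values `0` and `1` at these points. -/
theorem not_exists_circle_homotopy (H : C(unitInterval × ℝ, UnitAddCircle)) {h : ℝ → ℝ}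
    (hh : Continuous h) {a b : ℝ} (ha : h a = 0) (hb : h b = 1)
    (H_zero : ∀ s, H (0, s) = 0) (H_one : ∀ s, H (1, s) = (h s : UnitAddCircle))
    (Ha : ∀ t, H (t, a) ≠ ((1 / 2 : ℝ) : UnitAddCircle))
    (Hb : ∀ t, H (t, b) ≠ ((1 / 2 : ℝ) : UnitAddCircle)) : False := by
  have cov := AddCircle.isCoveringMap_coe (1 : ℝ)
  have H0 : ∀ s : ℝ, H (0, s) = ((ContinuousMap.const ℝ (0 : ℝ) s : ℝ) : UnitAddCircle) := by
    intro s; simp [H_zero]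
  set K := cov.liftHomotopy H (ContinuousMap.const ℝ (0 : ℝ)) H0
  have hK : ∀ q, ((K q : ℝ) : UnitAddCircle) = H q :=
    fun q => congrFun (cov.liftHomotopy_lifts H _ H0) q
  have hK0 : ∀ s, K (0, s) = 0 := fun s => cov.liftHomotopy_zero H _ H0 s
  have hsmall : ∀ s, (∀ t, H (t, s) ≠ ((1 / 2 : ℝ) : UnitAddCircle)) → |K (1, s)| < 1 / 2 :=
    fun s hs => abs_lt_half_of_coe_ne_half (f := fun t => K (t, s)) (by fun_prop) (hK0 s)
      (fun t => by rw [hK]; exact hs t) 1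
  have hint : ∀ s, ((K (1, s) - h s : ℝ) : UnitAddCircle) = 0 := fun s => by
    rw [AddCircle.coe_sub, hK, H_one, sub_self]
  -- `K (1, a)` is an integer of absolute value below `1/2`.
  have h1 : K (1, a) - h a = 0 := by
    have h2 := hint a
    have h3 := hsmall a Ha
    rw [AddCircle.coe_eq_zero_iff] at h2
    obtain ⟨n, hn⟩ := h2
    rw [ha] at hn ⊢
    simp only [zsmul_eq_mul, mul_one, sub_zero] at hn ⊢
    rw [← hn] at h3 ⊢
    have : |n| < 1 := by
      have : |(n : ℝ)| < 1 := by linarith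
      exact_mod_cast this
    rw [Int.abs_lt_one_iff] at this
    simp [this]
  -- Two lifts of the final map that agree at `a` agree at `b`, so `K (1, b) = 1`, against the bound
  -- `1/2`.
  have h2 := eq_zero_of_continuous_of_coe_eq_zero (f := fun s => K (1, s) - h s)
    (by fun_prop) hint h1 b
  have h3 := hsmall b Hb
  simp only [hb] at h2
  rw [show K (1, b) = 1 by linarith] at h3
  norm_num at h3

/-! ### Smoothness on the torus through the quotient map. -/

theorem contMDiff_torusProj {n : ℕ∞ω} :
    ContMDiff 𝓘(ℝ, ℝ × ℝ) 𝓘(ℝ, ℝ × ℝ) n torusProj := by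
  intro p
  rw [contMDiffAt_iff]
  refine ⟨torusProj_isLocalHomeomorph.continuous.continuousAt, ?_⟩
  have h := torus_chart_comp_proj (chart_mem_atlas (ℝ × ℝ) (torusProj p))
    (mem_chart_source (ℝ × ℝ) (torusProj p))
  have h2 : ContDiffAt ℝ n
      (fun q : ℝ × ℝ => q + (chartAt (ℝ × ℝ) (torusProj p) (torusProj p) - p)) p := by fun_prop
  exact (h2.congr_of_eventuallyEq h).contDiffWithinAt

/-- Smoothness of a map on the torus can be checked after composition with the quotient map. -/
theorem contMDiff_of_comp_torusProj {E H M : Type*} [NormedAddCommGroup E] [NormedSpace ℝ E]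
    [TopologicalSpace H] {I : ModelWithCorners ℝ E H} [TopologicalSpace M] [ChartedSpace H M]
    {n : ℕ∞ω} {f : Torus → M}
    (hf : ContMDiff 𝓘(ℝ, ℝ × ℝ) I n (fun p => f (torusProj p))) :
    ContMDiff 𝓘(ℝ, ℝ × ℝ) I n f := by
  intro x
  have h1 : ContMDiffAt 𝓘(ℝ, ℝ × ℝ) 𝓘(ℝ, ℝ × ℝ) n (chartAt (ℝ × ℝ) x) x :=
    contMDiffAt_of_mem_maximalAtlas (IsManifold.chart_mem_maximalAtlas x)
      (mem_chart_source (ℝ × ℝ) x)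
  refine ((hf _).comp x h1).congr_of_eventuallyEq ?_
  filter_upwards [(chartAt (ℝ × ℝ) x).open_source.mem_nhds (mem_chart_source (ℝ × ℝ) x)] with y hy
  simp only [Function.comp_apply]
  rw [← torus_chart_symm (chart_mem_atlas (ℝ × ℝ) x), OpenPartialHomeomorph.left_inv _ hy]

/-- Smoothness of a map on the product of the torus with a manifold can be checked after
composition with the quotient map. -/
theorem contMDiff_of_comp_prod_torusProj {E H M E' H' N : Type*}
    [NormedAddCommGroup E] [NormedSpace ℝ E] [TopologicalSpace H] {I : ModelWithCorners ℝ E H}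
    [TopologicalSpace M] [ChartedSpace H M]
    [NormedAddCommGroup E'] [NormedSpace ℝ E'] [TopologicalSpace H']
    {I' : ModelWithCorners ℝ E' H'} [TopologicalSpace N] [ChartedSpace H' N]
    {n : ℕ∞ω} {f : N × Torus → M}
    (hf : ContMDiff (I'.prod 𝓘(ℝ, ℝ × ℝ)) I n (fun q : N × (ℝ × ℝ) => f (q.1, torusProj q.2))) :
    ContMDiff (I'.prod 𝓘(ℝ, ℝ × ℝ)) I n f := by
  rintro ⟨t, x⟩
  have h1 : ContMDiffAt 𝓘(ℝ, ℝ × ℝ) 𝓘(ℝ, ℝ × ℝ) n (chartAt (ℝ × ℝ) x) x :=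
    contMDiffAt_of_mem_maximalAtlas (IsManifold.chart_mem_maximalAtlas x)
      (mem_chart_source (ℝ × ℝ) x)
  have h2 : ContMDiffAt (I'.prod 𝓘(ℝ, ℝ × ℝ)) (I'.prod 𝓘(ℝ, ℝ × ℝ)) n
      (fun q : N × Torus => (q.1, chartAt (ℝ × ℝ) x q.2)) (t, x) :=
    contMDiffAt_fst.prodMk (ContMDiffAt.comp (t, x) h1 contMDiffAt_snd)
  refine ((hf _).comp (t, x) h2).congr_of_eventuallyEq ?_
  filter_upwards [((chartAt (ℝ × ℝ) x).open_source.preimage continuous_snd).mem_nhds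
    (mem_chart_source (ℝ × ℝ) x)] with y hy
  simp only [Function.comp_apply]
  rw [← torus_chart_symm (chart_mem_atlas (ℝ × ℝ) x), OpenPartialHomeomorph.left_inv _ hy]

/-- Transition maps are locally translations, so tensors on the torus can be read with values in one
fixed space. -/
theorem tangentCoordChange_torus {x y z : Torus} (hx : z ∈ (chartAt (ℝ × ℝ) x).source)
    (hy : z ∈ (chartAt (ℝ × ℝ) y).source) :
    tangentCoordChange 𝓘(ℝ, ℝ × ℝ) x y z = ContinuousLinearMap.id ℝ (ℝ × ℝ) := by
  have hz : torusProj (chartAt (ℝ × ℝ) x z) = z := by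
    rw [← torus_chart_symm (chart_mem_atlas (ℝ × ℝ) x), OpenPartialHomeomorph.left_inv _ hx]
  have h := torus_chart_comp_proj (chart_mem_atlas (ℝ × ℝ) y) (p := chartAt (ℝ × ℝ) x z)
    (by rwa [hz])
  have h2 : HasFDerivAt (fun q : ℝ × ℝ => q + (chartAt (ℝ × ℝ) y (torusProj (chartAt (ℝ × ℝ) x z))
      - chartAt (ℝ × ℝ) x z)) (ContinuousLinearMap.id ℝ (ℝ × ℝ)) (chartAt (ℝ × ℝ) x z) :=
    (hasFDerivAt_id _).add_const _
  have h3 := h2.congr_of_eventuallyEq h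
  rw [tangentCoordChange_def]
  have h4 : (extChartAt 𝓘(ℝ, ℝ × ℝ) y ∘ (extChartAt 𝓘(ℝ, ℝ × ℝ) x).symm) =
      fun q => chartAt (ℝ × ℝ) y (torusProj q) := by
    funext q
    simp [torus_chart_symm (chart_mem_atlas (ℝ × ℝ) x)]
  rw [h4]
  simp only [modelWithCornersSelf_coe, range_id, fderivWithin_univ]
  exact h3.fderiv

/-! ### Diagonal Riemannian metrics. -/

/-- The bilinear form `a dx² + b dy²` on `ℝ²`. -/
def diagForm (a b : ℝ) : (ℝ × ℝ) →L[ℝ] (ℝ × ℝ) →L[ℝ] ℝ :=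
  a • (ContinuousLinearMap.fst ℝ ℝ ℝ).smulRight (ContinuousLinearMap.fst ℝ ℝ ℝ) +
    b • (ContinuousLinearMap.snd ℝ ℝ ℝ).smulRight (ContinuousLinearMap.snd ℝ ℝ ℝ)

theorem diagForm_apply (a b : ℝ) (v w : ℝ × ℝ) :
    diagForm a b v w = a * (v.1 * w.1) + b * (v.2 * w.2) := by
  simp [diagForm]

theorem contDiff_smul_add_smul {F : Type*} [NormedAddCommGroup F] [NormedSpace ℝ F] (A B : F)
    {n : ℕ∞ω} : ContDiff ℝ n fun p : ℝ × ℝ => p.1 • A + p.2 • B := by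
  fun_prop

theorem contDiff_diagForm {n : ℕ∞ω} : ContDiff ℝ n fun p : ℝ × ℝ => diagForm p.1 p.2 :=
  contDiff_smul_add_smul (F := (ℝ × ℝ) →L[ℝ] (ℝ × ℝ) →L[ℝ] ℝ) _ _

/-- The bilinear form `a dx² + b dy²` on the tangent spaces of the torus. -/
def torusDiagForm (a b : Torus → ℝ) (x : Torus) :
    TangentSpace 𝓘(ℝ, ℝ × ℝ) x →L[ℝ] TangentSpace 𝓘(ℝ, ℝ × ℝ) x →L[ℝ] ℝ :=
  diagForm (a x) (b x)

theorem symm_trivializationAt_torus {x y : Torus} (hy : y ∈ (chartAt (ℝ × ℝ) x).source)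
    (v : ℝ × ℝ) :
    (trivializationAt (ℝ × ℝ) (TangentSpace 𝓘(ℝ, ℝ × ℝ) : Torus → Type) x).symm y v = v := by
  have hT : (trivializationAt (ℝ × ℝ) (TangentSpace 𝓘(ℝ, ℝ × ℝ) : Torus → Type) x).symmL ℝ y
      = ContinuousLinearMap.id ℝ (ℝ × ℝ) := by
    refine (TangentBundle.symmL_trivializationAt_eq_core hy).trans ?_
    exact tangentCoordChange_torus hy (mem_chart_source _ _)
  rw [← Trivialization.symmL_apply (R := ℝ) _ (by simpa using hy)]
  exact congrArg (fun L => L v) hT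

theorem contMDiff_torusDiagForm {a b : Torus → ℝ} {n : ℕ∞ω}
    (ha : ContMDiff 𝓘(ℝ, ℝ × ℝ) 𝓘(ℝ) n a) (hb : ContMDiff 𝓘(ℝ, ℝ × ℝ) 𝓘(ℝ) n b) :
    ContMDiff 𝓘(ℝ, ℝ × ℝ) (𝓘(ℝ, ℝ × ℝ).prod 𝓘(ℝ, (ℝ × ℝ) →L[ℝ] (ℝ × ℝ) →L[ℝ] ℝ)) n
      (fun x : Torus => TotalSpace.mk' ((ℝ × ℝ) →L[ℝ] (ℝ × ℝ) →L[ℝ] ℝ)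
        (E := fun x : Torus => TangentSpace 𝓘(ℝ, ℝ × ℝ) x →L[ℝ]
          TangentSpace 𝓘(ℝ, ℝ × ℝ) x →L[ℝ] ℝ) x (torusDiagForm a b x)) := by
  intro x
  rw [contMDiffAt_section]
  have h1 : ContMDiff 𝓘(ℝ, ℝ × ℝ) 𝓘(ℝ, (ℝ × ℝ) →L[ℝ] (ℝ × ℝ) →L[ℝ] ℝ) n
      (fun x => diagForm (a x) (b x)) :=
    (contDiff_diagForm (n := n)).contMDiff.comp (ha.prodMk_space hb)
  refine (h1 x).congr_of_eventuallyEq ?_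
  filter_upwards [(chartAt (ℝ × ℝ) x).open_source.mem_nhds (mem_chart_source (ℝ × ℝ) x)] with y hy
  have hy' : y ∈ (trivializationAt (ℝ × ℝ)
      (TangentSpace 𝓘(ℝ, ℝ × ℝ) : Torus → Type) x).baseSet := by simpa using hy
  refine ContinuousLinearMap.ext fun v => ContinuousLinearMap.ext fun w => ?_
  rw [hom_trivializationAt_apply]
  refine (inCoordinates_apply_eq₂ hy' hy' (Set.mem_univ _)).trans ?_
  rw [symm_trivializationAt_torus hy, symm_trivializationAt_torus hy]
  simp
  rfl

theorem diagForm_symm (a b : ℝ) (v w : ℝ × ℝ) : diagForm a b v w = diagForm a b w v := by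
  rw [diagForm_apply, diagForm_apply]
  ring

theorem isVonNBounded_diagForm {a b : ℝ} (ha : 0 < a) (hb : 0 < b) :
    Bornology.IsVonNBounded ℝ {v : ℝ × ℝ | diagForm a b v v < 1} := by
  rw [NormedSpace.isVonNBounded_iff, isBounded_iff_forall_norm_le]
  -- If `|t| > 1 / c + 1`, then both `c |t| > 1` and `|t| > 1`, hence `c t² > 1`; this crude bound
  -- avoids square roots.
  have key : ∀ c t : ℝ, 0 < c → c * (t * t) < 1 → ‖t‖ ≤ 1 / c + 1 := by
    intro c t hc h
    rw [Real.norm_eq_abs]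
    by_contra! hlt
    rw [← abs_mul_abs_self t] at h
    have h1 : 1 < c * |t| := by
      have := mul_lt_mul_of_pos_left hlt hc
      rw [mul_add, mul_one_div_cancel hc.ne'] at this
      linarith
    have h2 : 1 < |t| := by
      have : 0 < 1 / c := by positivity
      linarith
    nlinarith
  refine ⟨max (1 / a + 1) (1 / b + 1), fun v hv => ?_⟩
  rw [mem_ofPred_eq, diagForm_apply] at hv
  have h1 : 0 ≤ a * (v.1 * v.1) := mul_nonneg ha.le (mul_self_nonneg _)
  have h2 : 0 ≤ b * (v.2 * v.2) := mul_nonneg hb.le (mul_self_nonneg _)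
  rw [Prod.norm_def]
  exact max_le_max (key a v.1 ha (by linarith)) (key b v.2 hb (by linarith))

theorem diagForm_self_pos {a b : ℝ} (ha : 0 < a) (hb : 0 < b) {v : ℝ × ℝ} (hv : v ≠ 0) :
    0 < diagForm a b v v := by
  rw [diagForm_apply]
  have h1 : 0 ≤ a * (v.1 * v.1) := mul_nonneg ha.le (mul_self_nonneg _)
  have h2 : 0 ≤ b * (v.2 * v.2) := mul_nonneg hb.le (mul_self_nonneg _)
  by_contra! h
  refine hv (Prod.ext ?_ ?_)
  · have : a * (v.1 * v.1) = 0 := by linarith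
    simpa [ha.ne'] using this
  · have : b * (v.2 * v.2) = 0 := by linarith
    simpa [hb.ne'] using this

/-- The Riemannian metric `a dx² + b dy²` on the torus. -/
def torusDiagMetric {a b : Torus → ℝ} (ha : ContMDiff 𝓘(ℝ, ℝ × ℝ) 𝓘(ℝ) ∞ a)
    (hb : ContMDiff 𝓘(ℝ, ℝ × ℝ) 𝓘(ℝ) ∞ b) (ha_pos : ∀ x, 0 < a x) (hb_pos : ∀ x, 0 < b x) :
    TorusMetric where
  inner := torusDiagForm a b
  symm x v w := diagForm_symm (a x) (b x) v w
  pos x _ hv := diagForm_self_pos (ha_pos x) (hb_pos x) hv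
  isVonNBounded x := isVonNBounded_diagForm (ha_pos x) (hb_pos x)
  contMDiff := contMDiff_torusDiagForm ha hb

/-! ### Lower and upper bounds for the Riemannian distance. -/

theorem mfderiv_torusProj_eq {E : Type*} [NormedAddCommGroup E] [NormedSpace ℝ E] {f : Torus → E}
    {p : ℝ × ℝ} (hf : MDifferentiableAt 𝓘(ℝ, ℝ × ℝ) 𝓘(ℝ, E) f (torusProj p)) :
    mfderiv 𝓘(ℝ, ℝ × ℝ) 𝓘(ℝ, E) f (torusProj p) = fderiv ℝ (fun q => f (torusProj q)) p := by
  have h : HasMFDerivAt 𝓘(ℝ, ℝ × ℝ) 𝓘(ℝ, E) (fun q => f (torusProj q)) p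
      (mfderiv 𝓘(ℝ, ℝ × ℝ) 𝓘(ℝ, E) f (torusProj p)) :=
    hf.hasMFDerivAt.comp p (hasMFDerivAt_torusProj p)
  exact h.mfderiv.symm.trans mfderiv_eq_fderiv

/-- A function whose differential is bounded by `c` with respect to the norm of `g` is
`c`-Lipschitz for the distance of `g`. -/
theorem TorusMetric.enorm_sub_le_edist (g : TorusMetric) {f : Torus → ℝ} {c : ℝ} (hc : 0 < c)
    (hf : ContMDiff 𝓘(ℝ, ℝ × ℝ) 𝓘(ℝ) 1 f)
    (hbound : ∀ p v : ℝ × ℝ,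
      ‖fderiv ℝ (fun q => f (torusProj q)) p v‖ ≤ c * √(g.inner (torusProj p) v v))
    (x y : Torus) :
    ‖f y - f x‖ₑ ≤ ENNReal.ofReal c * TorusMetric.edist g x y := by
  let : RiemannianBundle (TangentSpace 𝓘(ℝ, ℝ × ℝ) : Torus → Type) := ⟨g.toRiemannianMetric⟩
  change _ ≤ ENNReal.ofReal c * riemannianEDist 𝓘(ℝ, ℝ × ℝ) x y
  have hnorm : ∀ (z : Torus) (v : TangentSpace 𝓘(ℝ, ℝ × ℝ) z), ‖v‖ = √(g.inner z v v) :=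
    fun z v => norm_eq_sqrt_real_inner v
  have hbound' : ∀ (z : Torus) (v : TangentSpace 𝓘(ℝ, ℝ × ℝ) z),
      ‖(show ℝ from mfderiv 𝓘(ℝ, ℝ × ℝ) 𝓘(ℝ) f z v)‖ ≤ c * √(g.inner z v v) := fun z v => by
    obtain ⟨p, rfl⟩ := torusProj_surjective z
    rw [mfderiv_torusProj_eq (hf.mdifferentiableAt one_ne_zero)]
    exact hbound p v
  have hc0 : ENNReal.ofReal c ≠ 0 := by simpa using hc
  rw [mul_comm, ← ENNReal.div_le_iff_le_mul (Or.inl hc0) (Or.inl ENNReal.ofReal_ne_top)]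
  -- Every `r` above the distance exceeds the length of some `C¹` path; integrating the derivative
  -- of `f` along it gives the bound.
  refine le_of_forall_gt fun r hr => ?_
  obtain ⟨γ, rfl, rfl, hγ, hlen⟩ := exists_lt_of_riemannianEDist_lt hr
  refine lt_of_le_of_lt ?_ hlen
  rw [ENNReal.div_le_iff_le_mul (Or.inl hc0) (Or.inl ENNReal.ofReal_ne_top), mul_comm,
    pathELength_eq_lintegral_mfderivWithin_Icc,
    ← MeasureTheory.lintegral_const_mul' _ _ ENNReal.ofReal_ne_top]
  have D : ContDiffOn ℝ 1 (f ∘ γ) (Icc 0 1) :=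
    contMDiffOn_iff_contDiffOn.1 (hf.comp_contMDiffOn hγ)
  refine (enorm_sub_le_lintegral_derivWithin_Icc_of_contDiffOn_Icc D zero_le_one).trans ?_
  refine MeasureTheory.setLIntegral_mono' measurableSet_Icc fun t ht => ?_
  have hchain : mfderivWithin 𝓘(ℝ) 𝓘(ℝ) (f ∘ γ) (Icc 0 1) t =
      (mfderiv 𝓘(ℝ, ℝ × ℝ) 𝓘(ℝ) f (γ t)).comp
        (mfderivWithin 𝓘(ℝ) 𝓘(ℝ, ℝ × ℝ) γ (Icc 0 1) t) :=
    mfderiv_comp_mfderivWithin t (hf.mdifferentiableAt one_ne_zero)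
      ((hγ.mdifferentiableOn one_ne_zero) t ht)
      ((uniqueDiffOn_Icc zero_lt_one t ht).uniqueMDiffWithinAt)
  have hd : derivWithin (f ∘ γ) (Icc 0 1) t = (mfderiv 𝓘(ℝ, ℝ × ℝ) 𝓘(ℝ) f (γ t)
      (mfderivWithin 𝓘(ℝ) 𝓘(ℝ, ℝ × ℝ) γ (Icc 0 1) t 1) : ℝ) := by
    rw [← fderivWithin_derivWithin, ← mfderivWithin_eq_fderivWithin, hchain]
    rfl
  rw [← ofReal_norm, ← ofReal_norm, ← ENNReal.ofReal_mul hc.le, hnorm, hd]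
  exact ENNReal.ofReal_le_ofReal (hbound' _ _)

/-- The endpoints of a path of speed at most `r` for `g` are at distance at most `r`. -/
theorem TorusMetric.edist_le_of_path (g : TorusMetric) {γ : ℝ → Torus} {r : ℝ}
    (hγ : ContMDiff 𝓘(ℝ) 𝓘(ℝ, ℝ × ℝ) 1 γ)
    (hγ' : ∀ t, √(g.inner (γ t) (mfderiv 𝓘(ℝ) 𝓘(ℝ, ℝ × ℝ) γ t 1)
      (mfderiv 𝓘(ℝ) 𝓘(ℝ, ℝ × ℝ) γ t 1)) ≤ r) :
    TorusMetric.edist g (γ 0) (γ 1) ≤ ENNReal.ofReal r := by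
  let : RiemannianBundle (TangentSpace 𝓘(ℝ, ℝ × ℝ) : Torus → Type) := ⟨g.toRiemannianMetric⟩
  change riemannianEDist 𝓘(ℝ, ℝ × ℝ) (γ 0) (γ 1) ≤ _
  have hnorm : ∀ (z : Torus) (v : TangentSpace 𝓘(ℝ, ℝ × ℝ) z), ‖v‖ = √(g.inner z v v) :=
    fun z v => norm_eq_sqrt_real_inner v
  refine (riemannianEDist_le_pathELength hγ.contMDiffOn rfl rfl zero_le_one).trans ?_
  rw [pathELength_eq_lintegral_mfderiv_Icc]
  calc _ ≤ ∫⁻ t in Icc (0 : ℝ) 1, ENNReal.ofReal r := by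
        refine MeasureTheory.lintegral_mono fun t => ?_
        rw [← ofReal_norm, hnorm]
        exact ENNReal.ofReal_le_ofReal (hγ' t)
    _ = ENNReal.ofReal r := by simp

/-! ### Shears of the torus. -/

/-- The shear `(x, y) ↦ (x, y + h x)` of the plane. -/
def planeShear (h : ℝ → ℝ) (p : ℝ × ℝ) : ℝ × ℝ := (p.1, p.2 + h p.1)

/-- The shear `(x, y) ↦ (x, y + h x)` of the torus. -/
def torusShear {h : ℝ → ℝ} (hp : Function.Periodic h 1) (x : Torus) : Torus :=
  (x.1, x.2 + ((hp.lift x.1 : ℝ) : UnitAddCircle))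

theorem torusShear_torusProj {h : ℝ → ℝ} (hp : Function.Periodic h 1) (p : ℝ × ℝ) :
    torusShear hp (torusProj p) = torusProj (planeShear h p) := by
  simp [torusShear, torusProj, planeShear, Function.Periodic.lift_coe]

theorem torusShear_torusShear {h k : ℝ → ℝ} (hp : Function.Periodic h 1)
    (kp : Function.Periodic k 1) (hk : ∀ t, h t + k t = 0) (x : Torus) :
    torusShear kp (torusShear hp x) = x := by
  obtain ⟨p, rfl⟩ := torusProj_surjective x
  rw [torusShear_torusProj, torusShear_torusProj]
  congr 1
  exact Prod.ext rfl (by simp [planeShear, add_assoc, hk])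

theorem contMDiff_torusShear {h : ℝ → ℝ} (hp : Function.Periodic h 1) (hs : ContDiff ℝ ∞ h) :
    ContMDiff 𝓘(ℝ, ℝ × ℝ) 𝓘(ℝ, ℝ × ℝ) ∞ (torusShear hp) := by
  apply contMDiff_of_comp_torusProj
  simp only [torusShear_torusProj]
  refine contMDiff_torusProj.comp (ContDiff.contMDiff ?_)
  unfold planeShear
  fun_prop

/-- The shear `(x, y) ↦ (x, y + h x)` as a diffeomorphism of the torus. -/
def torusShearDiffeo {h : ℝ → ℝ} (hp : Function.Periodic h 1) (hs : ContDiff ℝ ∞ h) :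
    TorusDiffeo where
  toFun := torusShear hp
  invFun := torusShear (h := fun t => -h t) (fun t => congrArg Neg.neg (hp t))
  left_inv := torusShear_torusShear _ _ fun t => add_neg_cancel (h t)
  right_inv := torusShear_torusShear _ _ fun t => neg_add_cancel (h t)
  contMDiff_toFun := contMDiff_torusShear hp hs
  contMDiff_invFun := contMDiff_torusShear _ hs.neg

theorem torusShearDiffeo_torusProj {h : ℝ → ℝ} (hp : Function.Periodic h 1) (hs : ContDiff ℝ ∞ h)
    (p : ℝ × ℝ) : torusShearDiffeo hp hs (torusProj p) = torusProj (planeShear h p) :=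
  torusShear_torusProj hp p

theorem hasFDerivAt_planeShear {h : ℝ → ℝ} (hs : ContDiff ℝ ∞ h) (p : ℝ × ℝ) :
    HasFDerivAt (planeShear h) ((ContinuousLinearMap.fst ℝ ℝ ℝ).prod
      (ContinuousLinearMap.snd ℝ ℝ ℝ + deriv h p.1 • ContinuousLinearMap.fst ℝ ℝ ℝ)) p := by
  have h1 : HasDerivAt h (deriv h p.1) p.1 :=
    (hs.differentiable (by simp)).differentiableAt.hasDerivAt
  exact hasFDerivAt_fst.prodMk (hasFDerivAt_snd.add (h1.comp_hasFDerivAt p hasFDerivAt_fst))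

/-- The quotient map has identity derivative and intertwines the two shears, so the derivative is
that of the plane shear. -/
theorem mfderiv_torusShearDiffeo {h : ℝ → ℝ} (hp : Function.Periodic h 1) (hs : ContDiff ℝ ∞ h)
    (p v : ℝ × ℝ) :
    mfderiv 𝓘(ℝ, ℝ × ℝ) 𝓘(ℝ, ℝ × ℝ) (torusShearDiffeo hp hs) (torusProj p) v =
      (v.1, v.2 + deriv h p.1 * v.1) := by
  have h0 : MDifferentiableAt 𝓘(ℝ, ℝ × ℝ) 𝓘(ℝ, ℝ × ℝ) (torusShearDiffeo hp hs) (torusProj p) :=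
    (torusShearDiffeo hp hs).contMDiff.mdifferentiable (by simp) _
  have h1 : HasMFDerivAt 𝓘(ℝ, ℝ × ℝ) 𝓘(ℝ, ℝ × ℝ)
      (fun q => torusShearDiffeo hp hs (torusProj q)) p
      (mfderiv 𝓘(ℝ, ℝ × ℝ) 𝓘(ℝ, ℝ × ℝ) (torusShearDiffeo hp hs) (torusProj p)) :=
    h0.hasMFDerivAt.comp p (hasMFDerivAt_torusProj p)
  have h2 : HasMFDerivAt 𝓘(ℝ, ℝ × ℝ) 𝓘(ℝ, ℝ × ℝ)
      (fun q => torusShearDiffeo hp hs (torusProj q)) p ((ContinuousLinearMap.fst ℝ ℝ ℝ).prod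
      (ContinuousLinearMap.snd ℝ ℝ ℝ + deriv h p.1 • ContinuousLinearMap.fst ℝ ℝ ℝ)) :=
    ((hasMFDerivAt_torusProj (planeShear h p)).comp p
      (hasFDerivAt_planeShear hs p).hasMFDerivAt).congr_of_eventuallyEq
      (Filter.Eventually.of_forall (torusShearDiffeo_torusProj hp hs))
  have h3 := hasMFDerivAt_unique h1 h2
  exact congrArg (fun L : (ℝ × ℝ) →L[ℝ] (ℝ × ℝ) => L v) h3

theorem isAreaPreserving_torusShearDiffeo {h : ℝ → ℝ} (hp : Function.Periodic h 1)
    (hs : ContDiff ℝ ∞ h) : IsAreaPreserving (torusShearDiffeo hp hs) := by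
  intro x v w
  obtain ⟨p, rfl⟩ := torusProj_surjective x
  have hv := mfderiv_torusShearDiffeo hp hs p v
  have hw := mfderiv_torusShearDiffeo hp hs p w
  rw [hv, hw]
  simp only [torusArea]
  ring

theorem isInSympZero_torusShearDiffeo {h : ℝ → ℝ} (hp : Function.Periodic h 1)
    (hs : ContDiff ℝ ∞ h) : IsInSympZero (torusShearDiffeo hp hs) := by
  have hp' : ∀ c : ℝ, Function.Periodic (fun t => c * h t) 1 := fun c t => by
    simp only [hp t]
  have hs' : ∀ c : ℝ, ContDiff ℝ ∞ (fun t => c * h t) := fun c => contDiff_const.mul hs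
  -- Scaling the profile, `h` to `t * h`, joins the identity to the shear through shears.
  refine ⟨fun t => torusShearDiffeo (hp' t) (hs' t), ?_,
    fun t => isAreaPreserving_torusShearDiffeo _ _, fun x => ?_, fun x => ?_⟩
  · apply contMDiff_of_comp_prod_torusProj
    simp only [torusShearDiffeo_torusProj]
    have h1 : ContMDiff ((𝓡∂ 1).prod 𝓘(ℝ, ℝ × ℝ)) 𝓘(ℝ, ℝ × (ℝ × ℝ)) ∞
        (fun q : unitInterval × (ℝ × ℝ) => ((q.1 : ℝ), q.2)) :=
      (contMDiff_subtypeVal_Icc.comp contMDiff_fst).prodMk_space contMDiff_snd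
    have h2 : ContDiff ℝ ∞ (fun q : ℝ × (ℝ × ℝ) => planeShear (fun t => q.1 * h t) q.2) := by
      unfold planeShear
      fun_prop
    exact contMDiff_torusProj.comp (h2.contMDiff.comp h1)
  · obtain ⟨p, rfl⟩ := torusProj_surjective x
    rw [torusShearDiffeo_torusProj]
    simp [planeShear]
  · obtain ⟨p, rfl⟩ := torusProj_surjective x
    rw [torusShearDiffeo_torusProj, torusShearDiffeo_torusProj]
    simp [planeShear]

/-! ### Distances for warped metrics. -/

/-- A `1`-periodic function, as a function of the first coordinate on the torus. -/
def torusFst {f : ℝ → ℝ} (hf : Function.Periodic f 1) (x : Torus) : ℝ := hf.lift x.1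

/-- A `1`-periodic function, as a function of the second coordinate on the torus. -/
def torusSnd {f : ℝ → ℝ} (hf : Function.Periodic f 1) (x : Torus) : ℝ := hf.lift x.2

theorem torusFst_torusProj {f : ℝ → ℝ} (hf : Function.Periodic f 1) (p : ℝ × ℝ) :
    torusFst hf (torusProj p) = f p.1 := hf.lift_coe p.1

theorem torusSnd_torusProj {f : ℝ → ℝ} (hf : Function.Periodic f 1) (p : ℝ × ℝ) :
    torusSnd hf (torusProj p) = f p.2 := hf.lift_coe p.2

theorem contMDiff_torusFst {f : ℝ → ℝ} (hf : Function.Periodic f 1) {n : ℕ∞ω}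
    (hs : ContDiff ℝ n f) : ContMDiff 𝓘(ℝ, ℝ × ℝ) 𝓘(ℝ) n (torusFst hf) := by
  apply contMDiff_of_comp_torusProj
  simp only [torusFst_torusProj]
  exact (hs.comp contDiff_fst).contMDiff

theorem contMDiff_torusSnd {f : ℝ → ℝ} (hf : Function.Periodic f 1) {n : ℕ∞ω}
    (hs : ContDiff ℝ n f) : ContMDiff 𝓘(ℝ, ℝ × ℝ) 𝓘(ℝ) n (torusSnd hf) := by
  apply contMDiff_of_comp_torusProj
  simp only [torusSnd_torusProj]
  exact (hs.comp contDiff_snd).contMDiff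

/-- The metric `M² dx² + b(x)² dy²` on the torus. -/
def warpedMetric {M : ℝ} (hM : 0 < M) {b : ℝ → ℝ} (hb : Function.Periodic b 1)
    (hs : ContDiff ℝ ∞ b) (hpos : ∀ t, 0 < b t) : TorusMetric :=
  torusDiagMetric (a := fun _ => M ^ 2) (b := fun x => torusFst hb x ^ 2) contMDiff_const
    ((contMDiff_torusFst hb hs).pow 2) (fun _ => by positivity) (fun x => by
      obtain ⟨p, rfl⟩ := torusProj_surjective x
      rw [torusFst_torusProj]
      exact pow_pos (hpos _) 2)

theorem warpedMetric_inner {M : ℝ} (hM : 0 < M) {b : ℝ → ℝ} (hb : Function.Periodic b 1)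
    (hs : ContDiff ℝ ∞ b) (hpos : ∀ t, 0 < b t) (p v : ℝ × ℝ) :
    (warpedMetric hM hb hs hpos).inner (torusProj p) v v = (M * v.1) ^ 2 + (b p.1 * v.2) ^ 2 := by
  change diagForm (M ^ 2) (torusFst hb (torusProj p) ^ 2) v v = _
  rw [diagForm_apply, torusFst_torusProj]
  ring

theorem periodic_cos_pi_mul_sq : Function.Periodic (fun t : ℝ => Real.cos (Real.pi * t) ^ 2) 1 :=
  fun t => by simp [mul_add, Real.cos_add_pi]

theorem periodic_sin_pi_mul_sq : Function.Periodic (fun t : ℝ => Real.sin (Real.pi * t) ^ 2) 1 :=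
  fun t => by simp [mul_add, Real.sin_add_pi]

/-- The `x`-derivative contributes at most `M |v.1|` and the `y`-derivative at most `2π β |v.2| ≤ 8
β |v.2|`. Each of `M |v.1|` and `β |v.2|` is at most the square root, whence `9 = 1 + 8`. -/
theorem norm_fderiv_mul_cos_sq_le {M β : ℝ} {W : ℝ → ℝ}
    (hW : Differentiable ℝ W) (p v : ℝ × ℝ) (hWb : |W p.1| ≤ β) (hWM : |deriv W p.1| ≤ M) :
    ‖fderiv ℝ (fun q : ℝ × ℝ => W q.1 * Real.cos (Real.pi * q.2) ^ 2) p v‖ ≤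
      9 * √((M * v.1) ^ 2 + (β * v.2) ^ 2) := by
  have hβ : 0 ≤ β := (abs_nonneg _).trans hWb
  have h1 : HasFDerivAt (fun q : ℝ × ℝ => W q.1) (deriv W p.1 • ContinuousLinearMap.fst ℝ ℝ ℝ) p :=
    (hW p.1).hasDerivAt.comp_hasFDerivAt p hasFDerivAt_fst
  have h2 : HasDerivAt (fun t : ℝ => Real.cos (Real.pi * t) ^ 2)
      (2 * Real.cos (Real.pi * p.2) * (-Real.sin (Real.pi * p.2) * Real.pi)) p.2 := by
    have := (((hasDerivAt_id p.2).const_mul Real.pi).cos).fun_pow 2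
    simpa using this
  have h3 : HasFDerivAt (fun q : ℝ × ℝ => Real.cos (Real.pi * q.2) ^ 2)
      ((2 * Real.cos (Real.pi * p.2) * (-Real.sin (Real.pi * p.2) * Real.pi)) •
        ContinuousLinearMap.snd ℝ ℝ ℝ) p :=
    h2.comp_hasFDerivAt p hasFDerivAt_snd
  rw [(h1.fun_mul h3).fderiv]
  simp only [add_apply, smul_apply, ContinuousLinearMap.coe_fst',
    ContinuousLinearMap.coe_snd', smul_eq_mul]
  set c := Real.cos (Real.pi * p.2)
  set s := Real.sin (Real.pi * p.2)
  have hc : |c| ≤ 1 := Real.abs_cos_le_one _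
  have hsn : |s| ≤ 1 := Real.abs_sin_le_one _
  have e1 : |c ^ 2 * (deriv W p.1 * v.1)| ≤ M * |v.1| := by
    rw [abs_mul, abs_mul, abs_pow]
    have := pow_le_one₀ (n := 2) (abs_nonneg c) hc
    calc |c| ^ 2 * (|deriv W p.1| * |v.1|) ≤ 1 * (M * |v.1|) := by gcongr
      _ = _ := one_mul _
  have e2 : |W p.1 * (2 * c * (-s * Real.pi) * v.2)| ≤ 8 * (β * |v.2|) := by
    have hpi : |Real.pi| ≤ 4 := by rw [abs_of_pos Real.pi_pos]; exact Real.pi_le_four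
    simp only [abs_mul, abs_neg]
    calc |W p.1| * (|2| * |c| * (|s| * |Real.pi|) * |v.2|)
        ≤ β * (|2| * 1 * (1 * 4) * |v.2|) := by gcongr
      _ = _ := by rw [abs_of_pos (by norm_num : (0:ℝ) < 2)]; ring
  have e3 : M * |v.1| ≤ √((M * v.1) ^ 2 + (β * v.2) ^ 2) := by
    apply Real.le_sqrt_of_sq_le
    rw [mul_pow, mul_pow, sq_abs]
    nlinarith [sq_nonneg (β * v.2)]
  have e4 : β * |v.2| ≤ √((M * v.1) ^ 2 + (β * v.2) ^ 2) := by
    apply Real.le_sqrt_of_sq_le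
    rw [mul_pow, mul_pow, mul_pow, sq_abs]
    nlinarith [sq_nonneg (M * v.1)]
  rw [Real.norm_eq_abs, add_comm (W p.1 * _)]
  refine (abs_add_le _ _).trans ?_
  linarith

/-- A point of the circle `y = 0` over which a bump `W ≤ b` takes the value `1` is far from the
circle `y = 1/2`. -/
theorem one_le_edist_warpedMetric {M : ℝ} (hM : 0 < M) {b : ℝ → ℝ} (hb : Function.Periodic b 1)
    (hs : ContDiff ℝ ∞ b) (hpos : ∀ t, 0 < b t) {W : ℝ → ℝ} (hW : Function.Periodic W 1)
    (hWs : ContDiff ℝ ∞ W) (hWb : ∀ t, |W t| ≤ b t) (hWM : ∀ t, |deriv W t| ≤ M)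
    {s : ℝ} (hs1 : W s = 1) (s' : ℝ) :
    1 ≤ ENNReal.ofReal 9 * TorusMetric.edist (warpedMetric hM hb hs hpos)
      (torusProj (s, 0)) (torusProj (s', 1 / 2)) := by
  have hcos : ContDiff ℝ ∞ (fun t : ℝ => Real.cos (Real.pi * t) ^ 2) := by fun_prop
  -- The test function `W(x) cos² (π y)` is `1` at `(s, 0)` and vanishes on the circle `y = 1/2`.
  have hsm : ContMDiff 𝓘(ℝ, ℝ × ℝ) 𝓘(ℝ) ∞
      (fun x => torusFst hW x * torusSnd periodic_cos_pi_mul_sq x) :=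
    (contMDiff_torusFst hW hWs).mul (contMDiff_torusSnd _ hcos)
  have key := TorusMetric.enorm_sub_le_edist (warpedMetric hM hb hs hpos) (by norm_num : (0:ℝ) < 9)
    (hsm.of_le (by simp)) (fun p v => by
      rw [warpedMetric_inner]
      simp only [torusFst_torusProj, torusSnd_torusProj]
      exact norm_fderiv_mul_cos_sq_le (hWs.differentiable (by simp)) p v (hWb _) (hWM _))
    (torusProj (s, 0)) (torusProj (s', 1 / 2))
  simp only [torusFst_torusProj, torusSnd_torusProj] at key
  rw [show Real.cos (Real.pi * (1 / 2)) = 0 by rw [mul_one_div, Real.cos_pi_div_two]] at key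
  simpa [hs1] using key

/-- Vertical segments bound the distance from above. -/
theorem edist_warpedMetric_vertical_le {M : ℝ} (hM : 0 < M) {b : ℝ → ℝ}
    (hb : Function.Periodic b 1) (hs : ContDiff ℝ ∞ b) (hpos : ∀ t, 0 < b t) (p : ℝ × ℝ) (k : ℝ) :
    TorusMetric.edist (warpedMetric hM hb hs hpos) (torusProj p) (torusProj (p.1, p.2 + k)) ≤
      ENNReal.ofReal (b p.1 * |k|) := by
  have hd : ∀ t : ℝ, HasFDerivAt (fun t : ℝ => (p.1, p.2 + t * k))
      ((0 : ℝ →L[ℝ] ℝ).prod (k • ContinuousLinearMap.id ℝ ℝ)) t := fun t =>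
    (hasFDerivAt_const _ _).prodMk (((hasFDerivAt_id t).mul_const k).const_add p.2)
  have hm : ∀ t : ℝ, mfderiv 𝓘(ℝ) 𝓘(ℝ, ℝ × ℝ) (fun t : ℝ => torusProj (p.1, p.2 + t * k)) t =
      (0 : ℝ →L[ℝ] ℝ).prod (k • ContinuousLinearMap.id ℝ ℝ) := fun t =>
    ((hasMFDerivAt_torusProj _).comp t (hd t).hasMFDerivAt).mfderiv
  have h := TorusMetric.edist_le_of_path (warpedMetric hM hb hs hpos)
    (γ := fun t => torusProj (p.1, p.2 + t * k)) (r := b p.1 * |k|)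
    (contMDiff_torusProj.comp (ContDiff.contMDiff (by fun_prop))) (fun t => by
      have h1 : mfderiv 𝓘(ℝ) 𝓘(ℝ, ℝ × ℝ) (fun t : ℝ => torusProj (p.1, p.2 + t * k)) t 1 =
          ((0, k) : ℝ × ℝ) := by
        rw [hm t]
        exact Prod.ext rfl (mul_one k)
      rw [h1, warpedMetric_inner]
      refine (Real.sqrt_le_left ?_).2 ?_
      · exact mul_nonneg (hpos _).le (abs_nonneg _)
      · simp [mul_pow])
  simpa using h

/-! ### The warping function and the displacement of the shear. -/

/-- The warping function `ε / (ε + 2 sin² cos²)`: it equals `1` at `0` and `1/2`, and is of order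
`ε` away from these points. -/
def warp (ε t : ℝ) : ℝ :=
  ε / (ε + 2 * Real.sin (Real.pi * t) ^ 2 * Real.cos (Real.pi * t) ^ 2)

theorem warp_denom_pos {ε : ℝ} (hε : 0 < ε) (t : ℝ) :
    0 < ε + 2 * Real.sin (Real.pi * t) ^ 2 * Real.cos (Real.pi * t) ^ 2 := by positivity

theorem warp_pos {ε : ℝ} (hε : 0 < ε) (t : ℝ) : 0 < warp ε t :=
  div_pos hε (warp_denom_pos hε t)

theorem periodic_warp (ε : ℝ) : Function.Periodic (warp ε) 1 := fun t => by
  have h1 := periodic_sin_pi_mul_sq t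
  have h2 := periodic_cos_pi_mul_sq t
  simp only at h1 h2
  rw [warp, warp, h1, h2]

theorem contDiff_warp {ε : ℝ} (hε : 0 < ε) : ContDiff ℝ ∞ (warp ε) := by
  unfold warp
  exact contDiff_const.div (by fun_prop) fun t => (warp_denom_pos hε t).ne'

theorem warp_mul_le {ε m : ℝ} (hε : 0 < ε) (t : ℝ)
    (hm : m ≤ 2 * Real.sin (Real.pi * t) ^ 2 * Real.cos (Real.pi * t) ^ 2) : warp ε t * m ≤ ε := by
  rw [warp, div_mul_eq_mul_div, div_le_iff₀ (warp_denom_pos hε t)]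
  exact mul_le_mul_of_nonneg_left (by linarith) hε.le

/-- The derivative is continuous and periodic, hence bounded. This supplies the horizontal scale
`M`. -/
theorem exists_abs_deriv_le_of_periodic {f : ℝ → ℝ} (hf : Function.Periodic f 1)
    (hs : ContDiff ℝ ∞ f) : ∃ M : ℝ, ∀ t, |deriv f t| ≤ M := by
  have hp : Function.Periodic (deriv f) 1 := fun t => by
    rw [← deriv_comp_add_const]
    exact congrArg (fun u => deriv u t) (funext hf)
  have hb := hp.isBounded_of_continuous one_ne_zero (hs.continuous_deriv (by simp))
  obtain ⟨M, hM⟩ := isBounded_iff_forall_norm_le.1 hb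
  exact ⟨M, fun t => hM _ (mem_range_self t)⟩

/-- The shear by `sin² (π x)` moves every point by at most `ε` for the warped metric: near the
circles where the warping function is large, it is close to an integral translation. -/
theorem cZeroNorm_torusShearDiffeo_le {M ε : ℝ} (hM : 0 < M) (hε : 0 < ε)
    (hs : ContDiff ℝ ∞ fun t : ℝ => Real.sin (Real.pi * t) ^ 2) :
    TorusMetric.cZeroNorm (warpedMetric hM (periodic_warp ε) (contDiff_warp hε) (warp_pos hε))
      (torusShearDiffeo periodic_sin_pi_mul_sq hs) ≤ ENNReal.ofReal ε := by
  refine iSup_le fun x => ?_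
  obtain ⟨p, rfl⟩ := torusProj_surjective x
  rw [torusShearDiffeo_torusProj]
  have hsc := Real.sin_sq_add_cos_sq (Real.pi * p.1)
  have hs0 := sq_nonneg (Real.sin (Real.pi * p.1))
  have hc0 := sq_nonneg (Real.cos (Real.pi * p.1))
  -- The larger of `sin²` and `cos²` is at least `1/2`, so the smaller is at most `2 sin² cos²`, as
  -- `warp_mul_le` requires. When `sin²` is the larger, moving up by `sin²` is the same modulo `1`
  -- as moving down by `cos²`.
  rcases le_total (1 / 2) (Real.cos (Real.pi * p.1) ^ 2) with h | h
  · refine (edist_warpedMetric_vertical_le hM _ _ _ p (Real.sin (Real.pi * p.1) ^ 2)).trans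
      (ENNReal.ofReal_le_ofReal (warp_mul_le hε _ ?_))
    rw [abs_of_nonneg hs0]
    nlinarith
  · have hq : torusProj (planeShear (fun t => Real.sin (Real.pi * t) ^ 2) p) =
        torusProj (p.1, p.2 + -Real.cos (Real.pi * p.1) ^ 2) := by
      have : planeShear (fun t => Real.sin (Real.pi * t) ^ 2) p =
          (p.1, p.2 + -Real.cos (Real.pi * p.1) ^ 2) + (0, 1) := by
        refine Prod.ext (by simp [planeShear]) ?_
        simp only [planeShear, Prod.snd_add]
        linarith
      rw [this, torusProj_add]
      have h1 : torusProj (0, 1) = 0 := Prod.ext (AddCircle.coe_zero 1) (AddCircle.coe_period 1)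
      rw [h1, add_zero]
    rw [hq]
    refine (edist_warpedMetric_vertical_le hM _ _ _ p _).trans
      (ENNReal.ofReal_le_ofReal (warp_mul_le hε _ ?_))
    rw [abs_neg, abs_of_nonneg hc0]
    nlinarith

/-! ### Contradiction with a small isotopy. -/

theorem snd_ne_half_of_edist_lt (g : TorusMetric) {p : ℝ × ℝ}
    (h : ∀ s : ℝ, 1 ≤ ENNReal.ofReal 9 * TorusMetric.edist g (torusProj p)
      (torusProj (s, 1 / 2))) {x : Torus}
    (hx : ENNReal.ofReal 9 * TorusMetric.edist g (torusProj p) x < 1) :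
    x.2 ≠ ((1 / 2 : ℝ) : UnitAddCircle) := by
  intro hx2
  obtain ⟨s, hs⟩ := QuotientAddGroup.mk_surjective x.1
  have : x = torusProj (s, 1 / 2) := Prod.ext hs.symm hx2
  exact absurd (h s) (by rw [← this]; exact hx.not_ge)

theorem mainTheorem8 (C : ℝ) (hC : 1 < C) :
    ∃ g : TorusMetric, ∃ φ : TorusDiffeo,
      IsAreaPreserving φ ∧ IsInSympZero φ ∧
      ¬ ∃ Ψ : unitInterval → Torus ≃ₜ Torus, IsIsotopyFromId Ψ φ ∧
        ∀ t, TorusMetric.cZeroNorm g (Ψ t) ≤ ENNReal.ofReal C * TorusMetric.cZeroNorm g φ := by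
  have hC0 : 0 < C := by linarith
  -- With this `ε`, `9 C ε = 1/2`.
  obtain ⟨ε, hε, hCε⟩ : ∃ ε : ℝ, 0 < ε ∧ 9 * (C * ε) < 1 :=
    ⟨1 / (18 * C), by positivity, by field_simp; norm_num⟩
  have hsin : ContDiff ℝ ∞ fun t : ℝ => Real.sin (Real.pi * t) ^ 2 := by fun_prop
  have hcos : ContDiff ℝ ∞ fun t : ℝ => Real.cos (Real.pi * t) ^ 2 := by fun_prop
  have hb := contDiff_warp hε
  -- The bumps `W` will be `cos² · warp`, equal to `1` at `0`, and `sin² · warp`, equal to `1` at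
  -- `1/2`.
  have hbump : ∀ u : ℝ → ℝ, Function.Periodic u 1 → ContDiff ℝ ∞ u → (∀ t, |u t| ≤ 1) →
      Function.Periodic (fun t => u t * warp ε t) 1 ∧ ContDiff ℝ ∞ (fun t => u t * warp ε t) ∧
      (∀ t, |u t * warp ε t| ≤ warp ε t) ∧ ∃ M, ∀ t, |deriv (fun t => u t * warp ε t) t| ≤ M := by
    intro u hu hus hu1
    have h1 : Function.Periodic (fun t => u t * warp ε t) 1 := hu.mul (periodic_warp ε)
    have h2 : ContDiff ℝ ∞ (fun t => u t * warp ε t) := hus.mul hb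
    refine ⟨h1, h2, fun t => ?_, exists_abs_deriv_le_of_periodic h1 h2⟩
    rw [abs_mul, abs_of_pos (warp_pos hε t)]
    exact mul_le_of_le_one_left (warp_pos hε t).le (hu1 t)
  obtain ⟨pA, sA, bA, MA, hMA⟩ := hbump _ periodic_cos_pi_mul_sq hcos fun t => by
    rw [abs_of_nonneg (sq_nonneg _)]; exact Real.cos_sq_le_one _
  obtain ⟨pB, sB, bB, MB, hMB⟩ := hbump _ periodic_sin_pi_mul_sq hsin fun t => by
    rw [abs_of_nonneg (sq_nonneg _)]; exact Real.sin_sq_le_one _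
  -- `M` is chosen after `ε`; this is harmless, since the displacement bound uses only vertical
  -- segments.
  obtain ⟨M, hM, hAM, hBM⟩ : ∃ M : ℝ, 0 < M ∧ MA ≤ M ∧ MB ≤ M :=
    ⟨max 1 (max MA MB), by positivity, by simp, by simp⟩
  refine ⟨warpedMetric hM (periodic_warp ε) hb (warp_pos hε),
    torusShearDiffeo periodic_sin_pi_mul_sq hsin, isAreaPreserving_torusShearDiffeo _ _,
    isInSympZero_torusShearDiffeo _ _, ?_⟩
  rintro ⟨Ψ, ⟨hcont, hΨ0, hΨ1⟩, hΨ⟩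
  have hA := one_le_edist_warpedMetric hM (periodic_warp ε) hb (warp_pos hε) pA sA bA
    (fun t => (hMA t).trans hAM) (s := 0) (by simp [warp, hε.ne'])
  have hB := one_le_edist_warpedMetric hM (periodic_warp ε) hb (warp_pos hε) pB sB bB
    (fun t => (hMB t).trans hBM) (s := 1 / 2)
    (by simp [warp, hε.ne', ← div_eq_mul_inv])
  have hsmall : ∀ t x, ENNReal.ofReal 9 * TorusMetric.edist
      (warpedMetric hM (periodic_warp ε) hb (warp_pos hε)) x (Ψ t x) < 1 := by
    intro t x
    calc _ ≤ ENNReal.ofReal 9 * (ENNReal.ofReal C * ENNReal.ofReal ε) := by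
          gcongr
          refine (le_iSup (fun x => TorusMetric.edist _ x (Ψ t x)) x).trans ((hΨ t).trans ?_)
          gcongr
          exact cZeroNorm_torusShearDiffeo_le hM hε hsin
      _ = ENNReal.ofReal (9 * (C * ε)) := by
          rw [← ENNReal.ofReal_mul hC0.le, ← ENNReal.ofReal_mul (by norm_num)]
      _ < 1 := by rwa [ENNReal.ofReal_lt_one]
  have hproj : Continuous fun s : ℝ => torusProj (s, 0) :=
    torusProj_isLocalHomeomorph.continuous.comp (by fun_prop)
  -- The homotopy is the second coordinate of `Ψ` along the circle `y = 0`.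
  refine not_exists_circle_homotopy (h := fun t => Real.sin (Real.pi * t) ^ 2) (a := 0)
    (b := 1 / 2) ⟨fun q => (Ψ q.1 (torusProj (q.2, 0))).2, ?_⟩ hsin.continuous (by simp)
    (by simp [← div_eq_mul_inv]) (fun s => ?_) (fun s => ?_)
    (fun t => snd_ne_half_of_edist_lt _ hA (hsmall t _))
    (fun t => snd_ne_half_of_edist_lt _ hB (hsmall t _))
  · exact continuous_snd.comp (hcont.comp (continuous_fst.prodMk (hproj.comp continuous_snd)))
  · simp [hΨ0, torusProj]
  · simp only [ContinuousMap.coe_mk, hΨ1, torusShearDiffeo_torusProj]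
    simp [torusProj, planeShear]

end
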